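/- Let $X$ be a finite simple connected distance-regular graph with diameter $d$ that is not a cycle $C_n$ ($n\ge 3$), and let $M$ be the adjacency matrix $A$, the Laplacian $L=D-A$ or the signless Laplacian $Q=D+A$ of $X$, where $D$ is the diagonal matrix of vertex degrees. Put $U(t)=e^{-\mathrm{i}tM}$. Perfect state transfer from $\mathbf u$ to $\boldsymbol\mu$ means that $U(\tau)\mathbf u=\eta\boldsymbol\mu$ for some $\tau\in\mathbb R$ and some $\eta\in\mathbb C$ with $|\eta|=1$. Call two vertices antipodal if they are at distance $d$. Suppose that there is perfect state transfer from $\mathbf e_v$ to $\mathbf e_w$ for some two distinct vertices $v,w$ of $X$. Let $s\in\mathbb R\setminus\{0\}$ and let $a\ne b$ and $\alpha\neq\beta$ be vertices of $X$. Then $\mathbf e_a+s\mathbf e_b$ and $\mathbf e_\alpha+s\mathbf e_\beta$ represent distinct states (that is, neither is a unit complex multiple of the other) and perfect state transfer occurs from $\mathbf e_a+s\mathbf e_b$ to $\mathbf e_\alpha+s\mathbf e_\beta$ if and only if one of the following holds: (i) $\{a,b\}$ is not an antipodal pair, and either $\{a,\alpha\}$ and $\{b,\beta\}$ are antipodal pairs,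 or $s\in\{1,-1\}$ and $\{a,\beta\}$ and $\{b,\alpha\}$ are antipodal pairs (for $s=\pm1$, interchanging $\alpha$ and $\beta$ does not change the state represented by $\mathbf e_\alpha+s\mathbf e_\beta$); (ii) $\{a,b\}$ is an antipodal pair, $\alpha=b$, $\beta=a$, and $s\notin\{1,-1\}$. -/

import Mathlib

namespace PairTransfer

/-- A finite simple graph is distance-regular if it is connected and, for any two vertices
`x`, `y`, the number of neighbours of `y` that are one step closer to `x` than `y` is, and the
number of those that are one step farther, depend only on the distance of `x` and `y`. -/
def IsDistanceRegular {V : Type*} [Fintype V] (X : SimpleGraph V) [DecidableRel X.Adj] : Prop :=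
  X.Connected ∧ ∃ b c : ℕ → ℕ, ∀ x y : V,
    ((X.neighborFinset y).filter fun z => X.dist x z + 1 = X.dist x y).card = c (X.dist x y) ∧
    ((X.neighborFinset y).filter fun z => X.dist x z = X.dist x y + 1).card = b (X.dist x y)

/-- `X` is (isomorphic to) a cycle `C_n` with `n ≥ 3`. -/
def IsCycleGraph {V : Type*} (X : SimpleGraph V) : Prop :=
  ∃ n : ℕ, 3 ≤ n ∧ Nonempty (X ≃g SimpleGraph.cycleGraph n)

/-- Two vertices are antipodal if their distance is the diameter of the graph. -/
def IsAntipodalPair {V : Type*} (X : SimpleGraph V) (a b : V) : Prop :=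
  X.dist a b = X.diam

/-- The signless Laplacian matrix `Q = D + A`. -/
def signlessLapMatrix {V : Type*} [Fintype V] [DecidableEq V] (X : SimpleGraph V)
    [DecidableRel X.Adj] : Matrix V V ℂ :=
  X.degMatrix ℂ + X.adjMatrix ℂ

/-- The transition matrix `U_M(t) = exp(-itM)` of the continuous-time quantum walk with
Hamiltonian `M`. -/
noncomputable def transitionMatrix {V : Type*} [Fintype V] [DecidableEq V] (M : Matrix V V ℂ)
    (t : ℝ) : Matrix V V ℂ :=
  NormedSpace.exp ((-(Complex.I * (t : ℂ))) • M)

/-- Two vectors of the same norm represent the same quantum state if they differ by a phase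
factor. -/
def SameState {V : Type*} (u v : V → ℂ) : Prop :=
  ∃ η : ℂ, ‖η‖ = 1 ∧ u = η • v

/-- Perfect state transfer from `u` to `v` at some time `τ`: `U_M(τ) u = η v` for some phase
factor `η`. -/
def PerfectStateTransfer {V : Type*} [Fintype V] [DecidableEq V] (M : Matrix V V ℂ)
    (u v : V → ℂ) : Prop :=
  ∃ τ : ℝ, ∃ η : ℂ, ‖η‖ = 1 ∧ (transitionMatrix M τ).mulVec u = η • v

/-- The vertex state `e_a`. -/
def vertexState {V : Type*} [DecidableEq V] (a : V) : V → ℂ :=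
  Pi.single a 1

/-- The `s`-pair state `e_a + s e_b`, without its normalization factor `1 / √(1 + s²)`. -/
def pairState {V : Type*} [DecidableEq V] (s : ℝ) (a b : V) : V → ℂ :=
  vertexState a + (s : ℂ) • vertexState b

/-- There is perfect state transfer between two distinct vertices. -/
def HasVertexPST {V : Type*} [Fintype V] [DecidableEq V] (M : Matrix V V ℂ) : Prop :=
  ∃ a b : V, a ≠ b ∧ PerfectStateTransfer M (vertexState a) (vertexState b)

end PairTransfer

/-! The graph is regular, so `M` is affine in `A` and each U(t) has entries g(dist x y). Vertex
transfer at time τ leaves a single nonzero value of g; by unitarity that distance is attained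
exactly once from each vertex, and off cycles it must be the diameter (`antipodal_of_hasVertexPST`).
So U(τ) is a phase times the antipodal permutation and carries the pair a, b to its antipodes a',
b'. It remains to see that no other distinct pair state is reachable (`sameState_antipodes`); cases
(i) and (ii) record when the antipodal state differs from the initial one.

The times with U(t) scalar form a closed subgroup of ℝ missing τ, hence a cyclic one. If U(2t) is
scalar, then t is a scalar time or differs from τ by one (`sub_mem_scalarTimes`), so U(t) acts on
states as the identity or as U(τ). Pair states are real, so transfer at time t brings e_a + s e_b
back at time 2t up to a phase c. For s ≠ ±1, columns a and b of U(2t) − c have norms in ratio |s|,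
yet all columns have equal norm, so U(2t) = c. For s = ±1, spheres of radius strictly between 0 and
the diameter have at least three points (`three_le_card_sphere`), while columns of U(t) have norm 1.
This leaves only the pairs {a, b} and {a', b'} as targets, unless U(t) is a phase times a real
symmetric matrix (`pair_eq_or_real`), and then U(2t) is scalar again. -/

namespace PairTransfer

/-! ### Distance-regular graphs: intersection numbers, antipodes and sphere sizes -/

section Graph

variable {V : Type*} {X : SimpleGraph V}

/-- A geodesic passes through every intermediate distance. -/
lemma exists_dist_eq_of_le (hX : X.Connected) {x y : V} {i : ℕ} (hi : i ≤ X.dist x y) :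
    ∃ z, X.dist x z = i ∧ X.dist z y = X.dist x y - i := by
  obtain ⟨p, hp⟩ := hX.exists_walk_length_eq_dist x y
  have h1 := SimpleGraph.dist_le (p.take i)
  have h2 := SimpleGraph.dist_le (p.drop i)
  have h3 := hX.dist_triangle (u := x) (v := p.getVert i) (w := y)
  rw [SimpleGraph.Walk.take_length] at h1
  rw [SimpleGraph.Walk.drop_length] at h2
  refine ⟨p.getVert i, ?_, ?_⟩ <;> omega

lemma dist_le_diam_of_connected [Finite V] (hX : X.Connected) (x y : V) :
    X.dist x y ≤ X.diam := by
  have := hX.nonempty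
  exact SimpleGraph.dist_le_diam (SimpleGraph.connected_iff_ediam_ne_top.mp hX)

lemma dist_le_dist_add_one (hX : X.Connected) {x y z : V} (h : X.Adj y z) :
    X.dist x z ≤ X.dist x y + 1 := by
  have := hX.dist_triangle (u := x) (v := y) (w := z)
  rwa [SimpleGraph.dist_eq_one_iff_adj.mpr h] at this

lemma exists_dist_add_one (hX : X.Connected) {x y : V} {i : ℕ} (h : i + 1 ≤ X.dist x y) :
    ∃ v w, X.Adj v w ∧ X.dist x v = i ∧ X.dist x w = i + 1 := by
  obtain ⟨w, hw, -⟩ := exists_dist_eq_of_le hX h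
  obtain ⟨v, hv, hvw⟩ := exists_dist_eq_of_le hX (x := x) (y := w) (i := i) (by omega)
  exact ⟨v, w, SimpleGraph.dist_eq_one_iff_adj.mp (by omega), hv, hw⟩

/-- A finite connected graph that is regular of degree two is a cycle. -/
lemma isCycleGraph_of_degree_eq_two [Fintype V] [DecidableRel X.Adj] (hX : X.Connected)
    (hdeg : ∀ v, X.degree v = 2) : IsCycleGraph X := by
  classical
  have hne := hX.nonempty
  have hnt : Nontrivial V := by
    obtain ⟨v⟩ := hne
    have : 0 < X.degree v := by rw [hdeg]; norm_num
    obtain ⟨w, hw⟩ := (X.degree_pos_iff_exists_adj v).mp this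
    exact ⟨v, w, hw.ne⟩
  have hcyc : ¬ X.IsAcyclic := by
    intro hac
    have htree : X.IsTree := ⟨hX, hac⟩
    obtain ⟨v, hv⟩ := htree.exists_vert_degree_one_of_nontrivial
    rw [hdeg] at hv
    norm_num at hv
  rw [SimpleGraph.isAcyclic_iff_free_cycleGraph] at hcyc
  push Not at hcyc
  obtain ⟨n, hn, hfree⟩ := hcyc
  obtain ⟨f⟩ := hfree
  obtain ⟨m, rfl⟩ : ∃ m, n = m + 3 := ⟨n - 3, by omega⟩
  have hinj : Function.Injective f := f.injective
  -- Both degrees are 2, so the embedded cycle already contains all neighbours of its vertices;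
  -- connectedness then makes `f` onto.
  have hnbr : ∀ i, X.neighborFinset (f i) =
      ((SimpleGraph.cycleGraph (m + 3)).neighborFinset i).image f := by
    intro i
    symm
    apply Finset.eq_of_subset_of_card_le
    · intro z hz
      obtain ⟨k, hk, rfl⟩ := Finset.mem_image.mp hz
      rw [SimpleGraph.mem_neighborFinset] at hk ⊢
      exact f.toHom.map_adj hk
    · rw [Finset.card_image_of_injective _ hinj, SimpleGraph.card_neighborFinset_eq_degree,
        SimpleGraph.card_neighborFinset_eq_degree, hdeg, SimpleGraph.cycleGraph_degree_three_le]
  have hsurj : Function.Surjective f := by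
    intro v
    obtain ⟨p⟩ := hX.preconnected (f 0) v
    suffices ∀ u w (_ : X.Walk u w), (∃ i, f i = u) → ∃ i, f i = w from this _ _ p ⟨0, rfl⟩
    intro u w q
    induction q with
    | nil => exact id
    | cons hadj _ ih =>
      rintro ⟨i, rfl⟩
      apply ih
      have := (X.mem_neighborFinset _ _).mpr hadj
      rw [hnbr, Finset.mem_image] at this
      obtain ⟨k, _, hk⟩ := this
      exact ⟨k, hk⟩
  refine ⟨m + 3, hn, ⟨SimpleGraph.Iso.symm ⟨Equiv.ofBijective f ⟨hinj, hsurj⟩, ?_⟩⟩⟩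
  intro i k
  change X.Adj (f i) (f k) ↔ _
  constructor
  · intro h
    have := (X.mem_neighborFinset _ _).mpr h
    rw [hnbr, Finset.mem_image] at this
    obtain ⟨l, hl, hlk⟩ := this
    rw [← hinj hlk]
    exact (SimpleGraph.mem_neighborFinset _ _ _).mp hl
  · exact fun h => f.toHom.map_adj h

variable [Fintype V] [DecidableRel X.Adj]

/-- The neighbours of `y` that are one step closer to `x`. -/
noncomputable def closer (X : SimpleGraph V) [DecidableRel X.Adj] (x y : V) : Finset V :=
  (X.neighborFinset y).filter fun z => X.dist x z + 1 = X.dist x y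

/-- The neighbours of `y` that are one step farther from `x`. -/
noncomputable def farther (X : SimpleGraph V) [DecidableRel X.Adj] (x y : V) : Finset V :=
  (X.neighborFinset y).filter fun z => X.dist x z = X.dist x y + 1

/-- The vertices at distance `i` from `x`. -/
noncomputable def sphere (X : SimpleGraph V) (x : V) (i : ℕ) : Finset V :=
  Finset.univ.filter fun y => X.dist x y = i

omit [DecidableRel X.Adj] in
@[simp] lemma mem_sphere {x y : V} {i : ℕ} : y ∈ sphere X x i ↔ X.dist x y = i := by
  simp [sphere]

lemma mem_closer {x y z : V} : z ∈ closer X x y ↔ X.Adj y z ∧ X.dist x z + 1 = X.dist x y := by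
  simp [closer]

lemma mem_farther {x y z : V} : z ∈ farther X x y ↔ X.Adj y z ∧ X.dist x z = X.dist x y + 1 := by
  simp [farther]

lemma IsDistanceRegular.card_closer (hX : IsDistanceRegular X) {x y x' y' : V}
    (h : X.dist x y = X.dist x' y') : (closer X x y).card = (closer X x' y').card := by
  obtain ⟨-, b, c, hbc⟩ := hX
  exact (hbc x y).1.trans ((congrArg c h).trans (hbc x' y').1.symm)

lemma IsDistanceRegular.card_farther (hX : IsDistanceRegular X) {x y x' y' : V}
    (h : X.dist x y = X.dist x' y') : (farther X x y).card = (farther X x' y').card := by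
  obtain ⟨-, b, c, hbc⟩ := hX
  exact (hbc x y).2.trans ((congrArg b h).trans (hbc x' y').2.symm)

lemma IsDistanceRegular.degree_eq (hX : IsDistanceRegular X) (x y : V) :
    X.degree x = X.degree y := by
  have key : ∀ v, farther X v v = X.neighborFinset v := by
    intro v
    ext z
    rw [mem_farther, SimpleGraph.mem_neighborFinset, X.dist_self, zero_add,
      SimpleGraph.dist_eq_one_iff_adj, and_self]
  have := hX.card_farther (x := x) (y := x) (x' := y) (y' := y) (by simp)
  rwa [key, key] at this

/-- A geodesic from `x'` to `y'` has a step leaving the sphere of radius `X.dist x y`, and the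
number of such steps depends only on the radius. -/
lemma IsDistanceRegular.exists_farther (hX : IsDistanceRegular X) {x y x' y' : V}
    (h : X.dist x y < X.dist x' y') : (farther X x y).Nonempty := by
  obtain ⟨v, w, hvw, hv, hw⟩ := exists_dist_add_one hX.1 (Nat.succ_le_of_lt h)
  rw [← Finset.card_pos, ← hX.card_farther hv, Finset.card_pos]
  exact ⟨w, mem_farther.mpr ⟨hvw, by omega⟩⟩

/-- Every geodesic can be prolonged to length `X.diam`. -/
lemma IsDistanceRegular.exists_dist_eq_diam (hX : IsDistanceRegular X) (x y : V) :
    ∃ z, X.dist x z = X.diam ∧ X.dist y z = X.diam - X.dist x y := by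
  have hne := hX.1.nonempty
  obtain ⟨x₀, y₀, h₀⟩ := X.exists_dist_eq_diam
  have main : ∀ n, X.dist x y + n ≤ X.diam → ∃ z, X.dist x z = X.dist x y + n ∧ X.dist y z = n := by
    intro n
    induction n with
    | zero => exact fun _ => ⟨y, by simp⟩
    | succ n ih =>
      intro hn
      obtain ⟨z, hz, hyz⟩ := ih (by omega)
      obtain ⟨w, hw⟩ := hX.exists_farther (x := x) (y := z) (x' := x₀) (y' := y₀) (by omega)
      obtain ⟨hadj, hw⟩ := mem_farther.mp hw
      have h1 := dist_le_dist_add_one hX.1 (x := y) hadj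
      have h2 := hX.1.dist_triangle (u := x) (v := y) (w := w)
      exact ⟨w, by omega, by omega⟩
  have hle := dist_le_diam_of_connected hX.1 x y
  obtain ⟨z, hz, hyz⟩ := main (X.diam - X.dist x y) (by omega)
  exact ⟨z, by omega, hyz⟩

lemma IsDistanceRegular.exists_dist_eq (hX : IsDistanceRegular X) (x : V) {i : ℕ}
    (hi : i ≤ X.diam) : ∃ y, X.dist x y = i := by
  obtain ⟨z, hz, -⟩ := hX.exists_dist_eq_diam x x
  obtain ⟨y, hy, -⟩ := exists_dist_eq_of_le hX.1 (hz ▸ hi)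
  exact ⟨y, hy⟩

/-- Move the base point one step along a geodesic from `x'` to `y'`: neighbours of `y'` closer to
the new base point are also closer to `x'`. The same shift gives the bound for `farther`. -/
lemma IsDistanceRegular.card_closer_le (hX : IsDistanceRegular X) {x y x' y' : V}
    (h : X.dist x' y' = X.dist x y + 1) : (closer X x y).card ≤ (closer X x' y').card := by
  obtain ⟨v, hv, hvy⟩ := exists_dist_eq_of_le hX.1 (x := x') (y := y') (i := 1) (by omega)
  rw [hX.card_closer (x := x) (y := y) (x' := v) (y' := y') (by omega)]
  apply Finset.card_le_card
  intro z hz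
  obtain ⟨hadj, hz⟩ := mem_closer.mp hz
  have h1 := hX.1.dist_triangle (u := x') (v := v) (w := z)
  have h2 := dist_le_dist_add_one hX.1 (x := x') hadj.symm
  exact mem_closer.mpr ⟨hadj, by omega⟩

lemma IsDistanceRegular.card_farther_le_succ (hX : IsDistanceRegular X) {x y x' y' : V}
    (h : X.dist x y = X.dist x' y' + 1) : (farther X x y).card ≤ (farther X x' y').card := by
  obtain ⟨v, hv, hvy⟩ := exists_dist_eq_of_le hX.1 (x := x) (y := y) (i := 1) (by omega)
  rw [← hX.card_farther (x := v) (y := y) (x' := x') (y' := y') (by omega)]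
  apply Finset.card_le_card
  intro z hz
  obtain ⟨hadj, hz⟩ := mem_farther.mp hz
  have h1 := hX.1.dist_triangle (u := x) (v := v) (w := z)
  have h2 := dist_le_dist_add_one hX.1 (x := v) hadj
  exact mem_farther.mpr ⟨hadj, by omega⟩

lemma IsDistanceRegular.card_farther_le (hX : IsDistanceRegular X) {x y x' y' : V}
    (h : X.dist x' y' ≤ X.dist x y) : (farther X x y).card ≤ (farther X x' y').card := by
  obtain ⟨n, hn⟩ := Nat.exists_eq_add_of_le h
  induction n generalizing y with
  | zero => exact (hX.card_farther hn).le
  | succ n ih =>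
    obtain ⟨z, hz, -⟩ := exists_dist_eq_of_le hX.1 (x := x) (y := y)
      (i := X.dist x' y' + n) (by omega)
    exact (hX.card_farther_le_succ (x' := x) (y' := z) (by omega)).trans (ih (by omega) hz)

/-- If every vertex has exactly one vertex at distance `j > 0` and the graph is not a cycle,
then `j` is the diameter. -/
lemma IsDistanceRegular.eq_diam_of_existsUnique (hX : IsDistanceRegular X)
    (hcycle : ¬ IsCycleGraph X) {j : ℕ} (hj : 0 < j) (huniq : ∀ x, ∃! y, X.dist x y = j) :
    j = X.diam := by
  classical
  have hne := hX.1.nonempty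
  by_contra hjd
  obtain ⟨v, y₀, h₀⟩ := X.exists_dist_eq_diam
  have hlt : j + 1 ≤ X.dist v y₀ := by
    obtain ⟨y, hy, -⟩ := huniq v
    have := dist_le_diam_of_connected hX.1 v y
    omega
  have honly : ∀ {p q}, X.dist v p = j → X.dist v q = j → p = q :=
    fun hp hq => (huniq v).unique hp hq
  obtain ⟨w, z, hwz, hw, hz⟩ := exists_dist_add_one hX.1 hlt
  obtain ⟨y, w', hyw, hy, hw'⟩ := exists_dist_add_one hX.1 (x := v) (y := w) (i := j - 1) (by omega)
  obtain rfl : w' = w := honly (by omega) hw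
  -- Monotonicity moves both counts to the layers next to the singleton sphere of radius `j`, where
  -- all vertices counted lie in that sphere.
  have hc : (closer X v w').card ≤ 1 := by
    refine (hX.card_closer_le (x' := v) (y' := z) (by omega)).trans ?_
    refine Finset.card_le_one.mpr fun p hp q hq => honly ?_ ?_
    · have := (mem_closer.mp hp).2; omega
    · have := (mem_closer.mp hq).2; omega
  have hb : (farther X v w').card ≤ 1 := by
    refine (hX.card_farther_le_succ (x' := v) (y' := y) (by omega)).trans ?_
    refine Finset.card_le_one.mpr fun p hp q hq => honly ?_ ?_
    · have := (mem_farther.mp hp).2; omega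
    · have := (mem_farther.mp hq).2; omega
  have hdeg : X.degree w' = 2 := by
    apply le_antisymm
    · have hsub : X.neighborFinset w' ⊆ closer X v w' ∪ farther X v w' := by
        intro u hu
        have hadj := (X.mem_neighborFinset _ _).mp hu
        have h1 := dist_le_dist_add_one hX.1 (x := v) hadj
        have h2 := dist_le_dist_add_one hX.1 (x := v) hadj.symm
        rw [Finset.mem_union, mem_closer, mem_farther]
        by_cases hu' : X.dist v u = j
        · exact absurd (honly hu' hw) hadj.ne'
        · by_cases hlt : X.dist v u < j
          · exact Or.inl ⟨hadj, by omega⟩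
          · exact Or.inr ⟨hadj, by omega⟩
      have := (Finset.card_le_card hsub).trans (Finset.card_union_le _ _)
      rw [SimpleGraph.card_neighborFinset_eq_degree] at this
      omega
    · have hyz : y ≠ z := by
        rintro rfl
        omega
      rw [← Finset.card_pair hyz, ← SimpleGraph.card_neighborFinset_eq_degree]
      apply Finset.card_le_card
      intro u hu
      rw [Finset.mem_insert, Finset.mem_singleton] at hu
      rw [SimpleGraph.mem_neighborFinset]
      rcases hu with rfl | rfl
      · exact hyw.symm
      · exact hwz
  exact hcycle (isCycleGraph_of_degree_eq_two hX.1 fun x => (hX.degree_eq x w').trans hdeg)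

/-- If antipodes are unique, every vertex lies on a geodesic between antipodes. -/
lemma IsDistanceRegular.dist_add_dist_antipode (hX : IsDistanceRegular X)
    (huniq : ∀ x, ∃! y, X.dist x y = X.diam) {x x' : V} (h : X.dist x x' = X.diam) (y : V) :
    X.dist x y + X.dist x' y = X.diam := by
  -- The geodesic from `x` to `y` extends to an antipode of `x`, which can only be `x'`.
  obtain ⟨z, hz, hyz⟩ := hX.exists_dist_eq_diam x y
  obtain rfl := (huniq x).unique hz h
  have := dist_le_diam_of_connected hX.1 x y
  rw [X.dist_comm (u := z)]
  omega

lemma IsDistanceRegular.three_le_degree (hX : IsDistanceRegular X)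
    (hcycle : ¬ IsCycleGraph X) (hd : 2 ≤ X.diam) (x : V) : 3 ≤ X.degree x := by
  classical
  have hne := hX.1.nonempty
  obtain ⟨v, y₀, h₀⟩ := X.exists_dist_eq_diam
  obtain ⟨w, z, hwz, hw, hz⟩ := exists_dist_add_one hX.1 (x := v) (y := y₀) (i := 1) (by omega)
  have hvw := SimpleGraph.dist_eq_one_iff_adj.mp hw
  have h2 : 2 ≤ X.degree w := by
    have hvz : v ≠ z := by
      rintro rfl
      simp at hz
    rw [← Finset.card_pair hvz, ← SimpleGraph.card_neighborFinset_eq_degree]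
    apply Finset.card_le_card
    intro u hu
    rw [Finset.mem_insert, Finset.mem_singleton] at hu
    rw [SimpleGraph.mem_neighborFinset]
    rcases hu with rfl | rfl
    · exact hvw.symm
    · exact hwz
  have hne2 : X.degree w ≠ 2 := fun h =>
    hcycle (isCycleGraph_of_degree_eq_two hX.1 fun x => (hX.degree_eq x w).trans h)
  rw [hX.degree_eq x w]
  omega

/-- Double count the edges between the two spheres. Each inner vertex sends b_i edges outwards. Seen
from the antipode `x'`, an outer vertex is at distance d − i − 1 ≥ i and its inner neighbours are
farther, so it receives at most b_{d−i−1} ≤ b_i. -/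
lemma IsDistanceRegular.card_sphere_le_succ (hX : IsDistanceRegular X)
    (huniq : ∀ x, ∃! y, X.dist x y = X.diam) (x : V) {i : ℕ} (hi : 2 * i + 1 ≤ X.diam) :
    (sphere X x i).card ≤ (sphere X x (i + 1)).card := by
  classical
  obtain ⟨x', hx', -⟩ := huniq x
  obtain ⟨y₀, hy₀⟩ := hX.exists_dist_eq x (i := i) (by omega)
  have hpos : 0 < (farther X x y₀).card :=
    Finset.card_pos.mpr (hX.exists_farther (x' := x) (y' := x') (by omega))
  refine Nat.le_of_mul_le_mul_right ?_ hpos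
  refine Finset.card_mul_le_card_mul X.Adj ?_ ?_
  · intro y hy
    rw [mem_sphere] at hy
    rw [hX.card_farther (x' := x) (y' := y) (by omega)]
    apply Finset.card_le_card
    intro z hz
    obtain ⟨hadj, hz⟩ := mem_farther.mp hz
    rw [Finset.mem_bipartiteAbove, mem_sphere]
    exact ⟨by omega, hadj⟩
  · intro y hy
    rw [mem_sphere] at hy
    have hxy := hX.dist_add_dist_antipode huniq hx' y
    refine le_trans (Finset.card_le_card ?_)
      (hX.card_farther_le (x := x') (y := y) (x' := x) (y' := y₀) (by omega))
    intro z hz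
    rw [Finset.mem_bipartiteBelow, mem_sphere] at hz
    have hxz := hX.dist_add_dist_antipode huniq hx' z
    exact mem_farther.mpr ⟨hz.2.symm, by omega⟩

/-- If antipodes are unique and the graph is not a cycle, all other proper spheres have at least
three points. -/
lemma IsDistanceRegular.three_le_card_sphere (hX : IsDistanceRegular X)
    (hcycle : ¬ IsCycleGraph X) (huniq : ∀ x, ∃! y, X.dist x y = X.diam) (x : V) {i : ℕ}
    (hi : 0 < i) (hid : i < X.diam) : 3 ≤ (sphere X x i).card := by
  -- Sphere sizes are only known to grow up to the middle layer; larger spheres are read from the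
  -- antipode.
  have main : ∀ n, 2 * (n + 1) ≤ X.diam + 1 → ∀ x, 3 ≤ (sphere X x (n + 1)).card := by
    intro n
    induction n with
    | zero =>
      intro _ x
      have : sphere X x (0 + 1) = X.neighborFinset x := by
        ext z
        rw [mem_sphere, SimpleGraph.mem_neighborFinset, zero_add, SimpleGraph.dist_eq_one_iff_adj]
      rw [this]
      exact hX.three_le_degree hcycle (by omega) x
    | succ n ih =>
      exact fun hn x => (ih (by omega) x).trans (hX.card_sphere_le_succ huniq x (by omega))
  by_cases h : 2 * i ≤ X.diam + 1
  · obtain ⟨n, rfl⟩ : ∃ n, i = n + 1 := ⟨i - 1, by omega⟩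
    exact main n h x
  · obtain ⟨n, hn⟩ : ∃ n, X.diam - i = n + 1 := ⟨X.diam - i - 1, by omega⟩
    obtain ⟨x', hx', -⟩ := huniq x
    have : sphere X x i = sphere X x' (n + 1) := by
      ext y
      have := hX.dist_add_dist_antipode huniq hx' y
      rw [mem_sphere, mem_sphere]
      omega
    rw [this]
    exact main n (by omega) x'

end Graph

/-! ### The transition matrix depends only on distance -/

section Walk

variable {V : Type*} [Fintype V] {X : SimpleGraph V}

/-- The entries of the matrix depend only on the distance of the indices. -/
def IsDistanceInvariant (X : SimpleGraph V) (B : Matrix V V ℂ) : Prop :=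
  ∀ x y x' y', X.dist x y = X.dist x' y' → B x y = B x' y'

omit [Fintype V] in
lemma IsDistanceInvariant.exists_eq {B : Matrix V V ℂ} (hB : IsDistanceInvariant X B) :
    ∃ g : ℕ → ℂ, ∀ x y, B x y = g (X.dist x y) := by
  classical
  refine ⟨fun m => if h : ∃ p : V × V, X.dist p.1 p.2 = m then B h.choose.1 h.choose.2 else 0,
    fun x y => ?_⟩
  have h : ∃ p : V × V, X.dist p.1 p.2 = X.dist x y := ⟨(x, y), rfl⟩
  simp only [dif_pos h]
  exact hB _ _ _ _ h.choose_spec.symm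

variable [DecidableEq V] [DecidableRel X.Adj]

omit [DecidableEq V] in
lemma IsDistanceRegular.mul_adjMatrix (hX : IsDistanceRegular X) {B : Matrix V V ℂ}
    (hB : IsDistanceInvariant X B) : IsDistanceInvariant X (B * X.adjMatrix ℂ) := by
  obtain ⟨g, hg⟩ := hB.exists_eq
  -- Every neighbour is first counted as equidistant, then corrected. The values of `g` at the
  -- truncated 0 − 1 and beyond the diameter are harmless, as their counts vanish.
  have key : ∀ x y, (B * X.adjMatrix ℂ) x y = X.degree y * g (X.dist x y) +
      (closer X x y).card * (g (X.dist x y - 1) - g (X.dist x y)) +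
      (farther X x y).card * (g (X.dist x y + 1) - g (X.dist x y)) := by
    intro x y
    have h1 : ∀ z ∈ X.neighborFinset y, B x z = g (X.dist x y) +
        (if X.dist x z + 1 = X.dist x y then g (X.dist x y - 1) - g (X.dist x y) else 0) +
        (if X.dist x z = X.dist x y + 1 then g (X.dist x y + 1) - g (X.dist x y) else 0) := by
      intro z hz
      have hadj := (X.mem_neighborFinset _ _).mp hz
      have h2 := dist_le_dist_add_one hX.1 (x := x) hadj
      have h3 := dist_le_dist_add_one hX.1 (x := x) hadj.symm
      rw [hg]
      rcases lt_trichotomy (X.dist x z) (X.dist x y) with h | h | h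
      · rw [if_pos (by omega), if_neg (by omega), show X.dist x z = X.dist x y - 1 by omega]
        ring
      · rw [if_neg (by omega), if_neg (by omega), h]
        ring
      · rw [if_neg (by omega), if_pos (by omega), show X.dist x z = X.dist x y + 1 by omega]
        ring
    rw [SimpleGraph.mul_adjMatrix_apply, Finset.sum_congr rfl h1, Finset.sum_add_distrib,
      Finset.sum_add_distrib, ← Finset.sum_filter, ← Finset.sum_filter]
    simp only [Finset.sum_const, nsmul_eq_mul, SimpleGraph.card_neighborFinset_eq_degree]
    rfl
  intro x y x' y' h
  rw [key, key, hX.card_closer h, hX.card_farther h, h, hX.degree_eq y y']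

omit [Fintype V] [DecidableRel X.Adj] in
lemma isDistanceInvariant_one (hX : X.Connected) :
    IsDistanceInvariant X (1 : Matrix V V ℂ) := by
  intro x y x' y' h
  simp only [Matrix.one_apply, ← hX.dist_eq_zero_iff, h]

/-- The Hamiltonians under consideration are real affine functions of the adjacency matrix. -/
lemma IsDistanceRegular.exists_eq_smul_one_add (hX : IsDistanceRegular X) {M : Matrix V V ℂ}
    (hM : M = X.adjMatrix ℂ ∨ M = X.lapMatrix ℂ ∨ M = signlessLapMatrix X) :
    ∃ p q : ℝ, M = (p : ℂ) • (1 : Matrix V V ℂ) + (q : ℂ) • X.adjMatrix ℂ := by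
  obtain ⟨v⟩ := hX.1.nonempty
  have hD : X.degMatrix ℂ = (X.degree v : ℂ) • (1 : Matrix V V ℂ) := by
    rw [SimpleGraph.degMatrix, Matrix.smul_one_eq_diagonal]
    congr 1
    ext x
    rw [hX.degree_eq x v]
  rcases hM with rfl | rfl | rfl
  · exact ⟨0, 1, by simp⟩
  · exact ⟨X.degree v, -1, by simp [SimpleGraph.lapMatrix, hD, sub_eq_add_neg]⟩
  · exact ⟨X.degree v, 1, by simp [signlessLapMatrix, hD]⟩

open scoped Matrix.Norms.Operator in
lemma continuous_transitionMatrix (M : Matrix V V ℂ) : Continuous (transitionMatrix M) := by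
  unfold transitionMatrix
  exact NormedSpace.exp_continuous.comp (by fun_prop)

open scoped Matrix.Norms.Operator in
lemma hasSum_transitionMatrix (M : Matrix V V ℂ) (t : ℝ) :
    HasSum (fun n : ℕ => ((n.factorial : ℂ)⁻¹) • ((-(Complex.I * (t : ℂ))) • M) ^ n)
      (transitionMatrix M t) :=
  NormedSpace.exp_series_hasSum_exp' _

lemma transitionMatrix_zero (M : Matrix V V ℂ) : transitionMatrix M 0 = 1 := by
  simp [transitionMatrix]

lemma transitionMatrix_add (M : Matrix V V ℂ) (t t' : ℝ) :
    transitionMatrix M (t + t') = transitionMatrix M t * transitionMatrix M t' := by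
  unfold transitionMatrix
  rw [← Matrix.exp_add_of_commute _ _ (((Commute.refl M).smul_left _).smul_right _), ← add_smul]
  congr 2
  push_cast
  ring

lemma transitionMatrix_neg_mul (M : Matrix V V ℂ) (t : ℝ) :
    transitionMatrix M (-t) * transitionMatrix M t = 1 := by
  rw [← transitionMatrix_add, neg_add_cancel, transitionMatrix_zero]

lemma transitionMatrix_mul_neg (M : Matrix V V ℂ) (t : ℝ) :
    transitionMatrix M t * transitionMatrix M (-t) = 1 := by
  rw [← transitionMatrix_add, add_neg_cancel, transitionMatrix_zero]

lemma conjTranspose_transitionMatrix {M : Matrix V V ℂ} (hM : M.IsHermitian) (t : ℝ) :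
    (transitionMatrix M t).conjTranspose = transitionMatrix M (-t) := by
  unfold transitionMatrix
  rw [← Matrix.exp_conjTranspose, Matrix.conjTranspose_smul, hM.eq]
  congr 2
  simp

omit [Fintype V] in
lemma isHermitian_of_eq {M : Matrix V V ℂ} {p q : ℝ}
    (hM : M = (p : ℂ) • (1 : Matrix V V ℂ) + (q : ℂ) • X.adjMatrix ℂ) : M.IsHermitian := by
  have hA : (X.adjMatrix ℂ).conjTranspose = X.adjMatrix ℂ := by
    ext x y
    simp [SimpleGraph.adjMatrix_apply, X.adj_comm, apply_ite]
  rw [Matrix.IsHermitian, hM]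
  simp [Matrix.conjTranspose_add, Matrix.conjTranspose_smul, hA]

/-- Distance invariance survives multiplication by `M`, hence holds for its powers, and passes
entrywise to the exponential series. -/
lemma IsDistanceRegular.transitionMatrix_isDistanceInvariant (hX : IsDistanceRegular X)
    {M : Matrix V V ℂ} {p q : ℝ}
    (hM : M = (p : ℂ) • (1 : Matrix V V ℂ) + (q : ℂ) • X.adjMatrix ℂ) (t : ℝ) :
    IsDistanceInvariant X (transitionMatrix M t) := by
  have hpow : ∀ n, IsDistanceInvariant X (M ^ n) := by
    intro n
    induction n with
    | zero => simpa using isDistanceInvariant_one hX.1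
    | succ n ih =>
      intro x y x' y' h
      have h1 := ih x y x' y' h
      have h2 := hX.mul_adjMatrix ih x y x' y' h
      rw [pow_succ]
      nth_rw 2 4 [hM]
      simp [mul_add, h1, h2]
  intro x y x' y' h
  have hs := hasSum_transitionMatrix M t
  have h1 := Pi.hasSum.mp (Pi.hasSum.mp hs x) y
  have h2 := Pi.hasSum.mp (Pi.hasSum.mp hs x') y'
  refine h1.unique ?_
  convert h2 using 2 with n
  simp only [smul_pow, Matrix.smul_apply, hpow n x y x' y' h]

end Walk

/-! ### Pair states, unitarity and the group of scalar times -/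

section Transfer

variable {V : Type*} [DecidableEq V]

lemma vertexState_apply (a x : V) : vertexState a x = if x = a then 1 else 0 := by
  simp [vertexState, Pi.single_apply]

lemma pairState_apply (s : ℝ) (a b x : V) :
    pairState s a b x = (if x = a then 1 else 0) + (s : ℂ) * (if x = b then 1 else 0) := by
  simp [pairState, vertexState_apply]

lemma star_pairState (s : ℝ) (a b : V) : star (pairState s a b) = pairState s a b := by
  ext x
  rw [Pi.star_apply, pairState_apply]
  split_ifs <;> simp

/-- Pair states coincide up to phase only when the pairs agree, or when they are swapped and
`s = ±1`. -/
lemma sameState_pairState_iff {s : ℝ} (hs : s ≠ 0) {a b α β : V} (hab : a ≠ b) (hαβ : α ≠ β) :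
    SameState (pairState s a b) (pairState s α β) ↔
      (a = α ∧ b = β) ∨ ((s = 1 ∨ s = -1) ∧ a = β ∧ b = α) := by
  have hs' : (s : ℂ) ≠ 0 := by exact_mod_cast hs
  constructor
  · rintro ⟨η, -, h⟩
    have ha := congrFun h a
    have hb := congrFun h b
    simp only [pairState_apply, Pi.smul_apply, smul_eq_mul, if_true, if_neg hab, if_neg hab.symm,
      mul_zero, add_zero, zero_add, mul_one] at ha hb
    by_cases h1 : a = α
    · subst h1
      rw [if_neg hab.symm] at hb
      by_cases h2 : b = β
      · exact Or.inl ⟨rfl, h2⟩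
      · rw [if_neg h2] at hb
        simp [hs'] at hb
    · rw [if_neg h1] at ha
      by_cases h2 : a = β
      · subst h2
        rw [if_neg hab.symm] at hb
        by_cases h3 : b = α
        · refine Or.inr ⟨?_, rfl, h3⟩
          rw [if_pos rfl] at ha
          rw [if_pos h3] at hb
          have : (s : ℂ) * s = 1 := by
            rw [ha]
            linear_combination (s : ℂ) * hb
          exact mul_self_eq_one_iff.mp (by exact_mod_cast this)
        · rw [if_neg h3] at hb
          simp [hs'] at hb
      · rw [if_neg h2] at ha
        simp at ha
  · rintro (⟨rfl, rfl⟩ | ⟨hs1, rfl, rfl⟩)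
    · exact ⟨1, by simp, by simp⟩
    · refine ⟨s, ?_, ?_⟩
      · rcases hs1 with rfl | rfl <;> simp
      · have : (s : ℂ) * s = 1 := by rcases hs1 with rfl | rfl <;> simp
        ext x
        simp only [pairState_apply, Pi.smul_apply, smul_eq_mul]
        linear_combination -(if x = a then (1 : ℂ) else 0) * this

variable [Fintype V]

lemma mulVec_vertexState (B : Matrix V V ℂ) (a x : V) : B.mulVec (vertexState a) x = B x a := by
  simp [vertexState]

lemma mulVec_pairState (B : Matrix V V ℂ) (s : ℝ) (a b x : V) :
    B.mulVec (pairState s a b) x = B x a + s * B x b := by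
  rw [pairState, Matrix.mulVec_add, Matrix.mulVec_smul, Pi.add_apply, Pi.smul_apply,
    mulVec_vertexState, mulVec_vertexState, smul_eq_mul]

omit [DecidableEq V] [Fintype V] in
lemma sameState_of_smul_eq_smul {u v : V → ℂ} {c η : ℂ} (hc : ‖c‖ = 1) (hη : ‖η‖ = 1)
    (h : c • u = η • v) : SameState u v := by
  have hc0 : c ≠ 0 := by
    rintro rfl
    simp at hc
  refine ⟨c⁻¹ * η, by simp [hc, hη], ?_⟩
  rw [mul_smul, ← h, smul_smul, inv_mul_cancel₀ hc0, one_smul]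

variable {M : Matrix V V ℂ}

lemma sum_norm_sq_transitionMatrix (hM : M.IsHermitian) (t : ℝ) (a : V) :
    ∑ x, ‖transitionMatrix M t x a‖ ^ 2 = 1 := by
  have h := congrFun (congrFun (transitionMatrix_neg_mul M t) a) a
  rw [← conjTranspose_transitionMatrix hM, Matrix.mul_apply, Matrix.one_apply_eq] at h
  have h2 : ∀ x, (transitionMatrix M t).conjTranspose a x * transitionMatrix M t x a =
      ((‖transitionMatrix M t x a‖ ^ 2 : ℝ) : ℂ) := by
    intro x
    rw [Matrix.conjTranspose_apply, Complex.star_def, Complex.conj_mul']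
    push_cast
    rfl
  rw [Finset.sum_congr rfl fun x _ => h2 x] at h
  exact_mod_cast h

lemma norm_eq_one_of_eq_smul_one [Nonempty V] (hM : M.IsHermitian) {t : ℝ} {c : ℂ}
    (h : transitionMatrix M t = c • (1 : Matrix V V ℂ)) : ‖c‖ = 1 := by
  obtain ⟨a⟩ := ‹Nonempty V›
  have hs := sum_norm_sq_transitionMatrix hM t a
  rw [h, Finset.sum_eq_single a (fun x _ hx => by simp [Matrix.one_apply_ne hx]) (by simp)] at hs
  simp only [Matrix.smul_apply, Matrix.one_apply_eq, smul_eq_mul, mul_one] at hs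
  exact (pow_eq_one_iff_of_nonneg (norm_nonneg _) two_ne_zero).mp hs

lemma transitionMatrix_two_mul (M : Matrix V V ℂ) (t : ℝ) :
    transitionMatrix M (2 * t) = transitionMatrix M t * transitionMatrix M t := by
  rw [two_mul, transitionMatrix_add]

/-- If `U(t)` is a phase factor times a real symmetric matrix, then `U(2t)` is scalar. -/
lemma transitionMatrix_two_mul_of_real (hM : M.IsHermitian) {t : ℝ} {η : ℂ} (hη : ‖η‖ = 1)
    (hsymm : ∀ x y, transitionMatrix M t x y = transitionMatrix M t y x)
    (h : ∀ x y, ∃ r : ℝ, transitionMatrix M t x y = η * r) :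
    transitionMatrix M (2 * t) = (η ^ 2) • (1 : Matrix V V ℂ) := by
  have hη' : η * (starRingEnd ℂ) η = 1 := by
    rw [Complex.mul_conj', hη]
    simp
  -- By symmetry U(−t) = U(t)* is the entrywise conjugate of U(t), and conjugating η r with r real
  -- divides it by η².
  have key : transitionMatrix M t = (η ^ 2) • transitionMatrix M (-t) := by
    rw [← conjTranspose_transitionMatrix hM]
    ext x y
    obtain ⟨r, hr⟩ := h x y
    rw [Matrix.smul_apply, Matrix.conjTranspose_apply, hsymm y x, hr]
    simp only [Complex.star_def, map_mul, Complex.conj_ofReal, smul_eq_mul]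
    linear_combination -η * r * hη'
  rw [transitionMatrix_two_mul]
  nth_rw 2 [key]
  rw [Matrix.mul_smul, transitionMatrix_mul_neg]

/-- Perfect state transfer between real states returns the initial state at twice the time. -/
lemma transitionMatrix_two_mul_mulVec (hM : M.IsHermitian) {t : ℝ} {η : ℂ} (hη : ‖η‖ = 1)
    (hsymm : ∀ x y, transitionMatrix M t x y = transitionMatrix M t y x) {u v : V → ℂ}
    (hu : star u = u) (hv : star v = v) (h : (transitionMatrix M t).mulVec u = η • v) :
    (transitionMatrix M (2 * t)).mulVec u = (η ^ 2) • u := by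
  have hη' : η * (starRingEnd ℂ) η = 1 := by
    rw [Complex.mul_conj', hη]
    simp
  -- This is the complex conjugate of `h`, as `u` and `v` are real and U(t) is symmetric.
  have h1 : (transitionMatrix M (-t)).mulVec u = (starRingEnd ℂ η) • v := by
    have h2 := congrArg star h
    rw [Matrix.star_mulVec, conjTranspose_transitionMatrix hM, hu, star_smul, hv,
      ← Matrix.mulVec_transpose] at h2
    rw [← Complex.star_def, ← h2]
    congr 1
    rw [← conjTranspose_transitionMatrix hM]
    ext x y
    rw [Matrix.transpose_apply, Matrix.conjTranspose_apply, Matrix.conjTranspose_apply, hsymm]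
  have h3 : v = η • (transitionMatrix M (-t)).mulVec u := by
    rw [h1, smul_smul, hη', one_smul]
  rw [transitionMatrix_two_mul, ← Matrix.mulVec_mulVec, h, Matrix.mulVec_smul]
  nth_rw 1 [h3]
  rw [Matrix.mulVec_smul, Matrix.mulVec_mulVec, transitionMatrix_mul_neg, Matrix.one_mulVec,
    smul_smul, sq]

/-- The times at which the transition matrix is scalar. -/
def scalarTimes (M : Matrix V V ℂ) (hM : M.IsHermitian) : AddSubgroup ℝ where
  carrier := {t | ∃ c : ℂ, transitionMatrix M t = c • (1 : Matrix V V ℂ)}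
  zero_mem' := ⟨1, by simp [transitionMatrix_zero]⟩
  add_mem' := by
    rintro t t' ⟨c, hc⟩ ⟨c', hc'⟩
    exact ⟨c * c', by simp [transitionMatrix_add, hc, hc', smul_smul, mul_comm]⟩
  neg_mem' := by
    rintro t ⟨c, hc⟩
    exact ⟨star c, by
      rw [← conjTranspose_transitionMatrix hM, hc, Matrix.conjTranspose_smul,
        Matrix.conjTranspose_one]⟩

lemma mem_scalarTimes {hM : M.IsHermitian} {t : ℝ} :
    t ∈ scalarTimes M hM ↔ ∃ c : ℂ, transitionMatrix M t = c • (1 : Matrix V V ℂ) := Iff.rfl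

-- Being scalar means lying on the line spanned by the identity, which is closed. Closedness
-- excludes a dense proper subgroup.
open scoped Matrix.Norms.Operator in
lemma isClosed_scalarTimes (hM : M.IsHermitian) : IsClosed (scalarTimes M hM : Set ℝ) := by
  have h : (scalarTimes M hM : Set ℝ) = transitionMatrix M ⁻¹'
      (Submodule.span ℂ {(1 : Matrix V V ℂ)} : Set (Matrix V V ℂ)) := by
    ext t
    simp only [SetLike.mem_coe, mem_scalarTimes, Set.mem_preimage, Submodule.mem_span_singleton,
      eq_comm]
  rw [h]
  exact (Submodule.closed_of_finiteDimensional _).preimage (continuous_transitionMatrix M)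

/-- If `U(τ)` is not scalar but `U(2τ)` is, then any other time with this property differs from
`τ` by a time at which the transition matrix is scalar. -/
lemma sub_mem_scalarTimes (hM : M.IsHermitian) {t τ : ℝ} (hτ : τ ∉ scalarTimes M hM)
    (hτ2 : 2 * τ ∈ scalarTimes M hM) (ht2 : 2 * t ∈ scalarTimes M hM) :
    t ∈ scalarTimes M hM ∨ t - τ ∈ scalarTimes M hM := by
  rcases (scalarTimes M hM).dense_or_cyclic with hd | ⟨g, hg⟩
  · refine absurd ?_ hτ
    have := hd.closure_eq
    rw [(isClosed_scalarTimes hM).closure_eq] at this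
    rw [← SetLike.mem_coe, this]
    trivial
  · have hmem : ∀ n : ℤ, (n : ℝ) * g ∈ scalarTimes M hM := by
      intro n
      rw [hg, AddSubgroup.mem_closure_singleton]
      exact ⟨n, by simp⟩
    rw [hg, AddSubgroup.mem_closure_singleton] at hτ2 ht2
    obtain ⟨n, hn⟩ := hτ2
    obtain ⟨m, hm⟩ := ht2
    rw [zsmul_eq_mul] at hn hm
    -- An even multiple of `g` would make τ a scalar time, so 2τ is an odd one; the parity of 2t
    -- then decides between `t` and `t - τ`.
    rcases Int.even_or_odd' n with ⟨k, rfl | rfl⟩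
    · refine absurd ?_ hτ
      convert hmem k using 1
      push_cast at hn
      linarith
    · rcases Int.even_or_odd' m with ⟨l, rfl | rfl⟩
      · left
        convert hmem l using 1
        push_cast at hm
        linarith
      · right
        convert hmem (l - k) using 1
        push_cast at hm hn ⊢
        linarith

end Transfer

/-! ### Counting argument for s = ±1 -/

section Combinatorial

variable {V : Type*} [Fintype V] {X : SimpleGraph V}

/-- Grouping a unit column by distance gives a mass budget: large spheres force small values of `g`.
-/
lemma sum_card_sphere_mul_le {g : ℕ → ℂ} {a : V} (hg : ∑ x, ‖g (X.dist a x)‖ ^ 2 = 1)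
    (T : Finset ℕ) : ∑ i ∈ T, ((sphere X a i).card : ℝ) * ‖g i‖ ^ 2 ≤ 1 := by
  classical
  have h : ∀ i ∈ T, ((sphere X a i).card : ℝ) * ‖g i‖ ^ 2 =
      ∑ x ∈ (Finset.univ.filter fun x => X.dist a x ∈ T) with X.dist a x = i,
        ‖g (X.dist a x)‖ ^ 2 := by
    intro i hi
    have : ((Finset.univ.filter fun x => X.dist a x ∈ T).filter fun x => X.dist a x = i) =
        sphere X a i := by
      ext x
      simp only [Finset.mem_filter, Finset.mem_univ, true_and, mem_sphere]
      exact ⟨fun h => h.2, fun h => ⟨h ▸ hi, h⟩⟩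
    rw [this, ← nsmul_eq_mul, ← Finset.sum_const]
    exact Finset.sum_congr rfl fun x hx => by rw [mem_sphere.mp hx]
  rw [Finset.sum_congr rfl h, Finset.sum_fiberwise_of_maps_to (by simp), ← hg]
  exact Finset.sum_le_sum_of_subset_of_nonneg (Finset.subset_univ _) fun _ _ _ => by positivity

variable [DecidableEq V] [DecidableRel X.Adj]

/-- If `U(t)` maps `e_a ± e_b` to `e_α ± e_β` up to phase, then the pair `α, β` consists of `a, b`
or of their antipodes, or else `U(t)` is a phase factor times a real matrix. -/
lemma IsDistanceRegular.pair_eq_or_real (hX : IsDistanceRegular X)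
    (hcycle : ¬ IsCycleGraph X) (huniq : ∀ x, ∃! y, X.dist x y = X.diam) {g : ℕ → ℂ}
    (hg : ∀ a, ∑ x, ‖g (X.dist a x)‖ ^ 2 = 1)
    {s η : ℂ} (hs : s = 1 ∨ s = -1) (hη : ‖η‖ = 1) {a b a' b' α β : V} (hab : a ≠ b)
    (hαβ : α ≠ β) (ha' : X.dist a a' = X.diam) (hb' : X.dist b b' = X.diam)
    (hpair : ∀ x, g (X.dist a x) + s * g (X.dist b x) =
      η * ((if x = α then 1 else 0) + s * (if x = β then 1 else 0))) :
    (α = a ∧ β = b) ∨ (α = b ∧ β = a) ∨ (α = a' ∧ β = b') ∨ (α = b' ∧ β = a') ∨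
      ∀ h ≤ X.diam, ∃ r : ℝ, g h = η * r := by
  have hη0 : η ≠ 0 := by
    rintro rfl
    simp at hη
  have hs2 : s * s = 1 := by rcases hs with rfl | rfl <;> simp
  have hsn : ‖s‖ = 1 := by rcases hs with rfl | rfl <;> simp
  have hle := dist_le_diam_of_connected hX.1
  have hα := hpair α
  rw [if_pos rfl, if_neg hαβ, mul_zero, add_zero, mul_one] at hα
  have ha'b' : a' ≠ b' := by
    rintro rfl
    exact hab ((huniq a').unique (by rw [X.dist_comm, ha']) (by rw [X.dist_comm, hb']))
  by_cases hij : X.dist a α = X.dist b α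
  · right; right; right; right
    obtain rfl : s = 1 := by
      rcases hs with rfl | rfl
      · rfl
      · rw [hij] at hα
        exact absurd (by linear_combination -hα) hη0
    set i := X.dist a α with hi
    have hgi : g i = η * ((1 / 2 : ℝ) : ℂ) := by
      rw [← hij] at hα
      push_cast
      linear_combination hα / 2
    have hgin : ‖g i‖ = 1 / 2 := by
      rw [hgi, norm_mul, hη, one_mul, Complex.norm_real]
      norm_num
    have hi0 : 0 < i := by
      rw [Nat.pos_iff_ne_zero]
      intro h0
      exact hab ((hX.1.dist_eq_zero_iff.mp h0).trans
        (hX.1.dist_eq_zero_iff.mp (hij ▸ h0)).symm)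
    have hid : i < X.diam := by
      refine lt_of_le_of_ne (hle _ _) fun hd => hab ((huniq α).unique ?_ ?_)
      · rw [X.dist_comm, ← hi, hd]
      · rw [X.dist_comm, ← hij, hd]
    -- At a third point of the sphere the pair sum vanishes, so the distance from `b` carries the
    -- value −η/2.
    obtain ⟨x, hxi, hxα, hxβ⟩ : ∃ x, X.dist a x = i ∧ x ≠ α ∧ x ≠ β := by
      by_contra! hno
      have hsub : sphere X a i ⊆ {α, β} := by
        intro x hx
        rw [mem_sphere] at hx
        rw [Finset.mem_insert, Finset.mem_singleton]
        by_cases hxα : x = α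
        · exact Or.inl hxα
        · exact Or.inr (hno x hx hxα)
      have := (Finset.card_le_card hsub).trans Finset.card_le_two
      have := hX.three_le_card_sphere hcycle huniq a hi0 hid
      omega
    set l := X.dist b x with hl
    have hgl : g l = η * ((-(1 / 2) : ℝ) : ℂ) := by
      have := hpair x
      rw [if_neg hxα, if_neg hxβ, hxi, ← hl, hgi] at this
      push_cast at this ⊢
      linear_combination this
    have hgln : ‖g l‖ = 1 / 2 := by
      rw [hgl, norm_mul, hη, one_mul, Complex.norm_real]
      norm_num
    have hil : i ≠ l := by
      intro h
      rw [← h, hgi] at hgl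
      have := mul_left_cancel₀ hη0 hgl
      norm_num [Complex.ext_iff] at this
    intro h hh
    by_cases hhi : h = i
    · exact ⟨_, hhi ▸ hgi⟩
    by_cases hhl : h = l
    · exact ⟨_, hhl ▸ hgl⟩
    refine ⟨0, ?_⟩
    -- Radii `i` and `l` already use 3 · 1/4 + 1/4 = 1, so nothing is left for `h`.
    have hmass := sum_card_sphere_mul_le (hg b) {h, i, l}
    rw [Finset.sum_insert (by simp [hhi, hhl]), Finset.sum_pair hil, hgin, hgln] at hmass
    have h3 : (3 : ℝ) ≤ (sphere X b i).card := by
      exact_mod_cast hX.three_le_card_sphere hcycle huniq b hi0 hid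
    have h1 : (1 : ℝ) ≤ (sphere X b l).card := by
      exact_mod_cast Finset.card_pos.mpr ⟨x, mem_sphere.mpr rfl⟩
    have h1' : (1 : ℝ) ≤ (sphere X b h).card := by
      obtain ⟨y, hy⟩ := hX.exists_dist_eq b hh
      exact_mod_cast Finset.card_pos.mpr ⟨y, mem_sphere.mpr hy⟩
    have hsq : ‖g h‖ ^ 2 ≤ 0 := by
      have := mul_le_mul_of_nonneg_right h1' (sq_nonneg ‖g h‖)
      linarith
    have : g h = 0 := by
      rw [← norm_eq_zero]
      exact pow_eq_zero_iff two_ne_zero |>.mp (le_antisymm hsq (sq_nonneg _))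
    simp [this]
  -- If `y` sees `a` and `b` at the distances of `α` exchanged, the pair sum at `y` is s η ≠ 0, so
  -- `y` supports the target.
  · have hswap : ∀ y, X.dist a y = X.dist b α → X.dist b y = X.dist a α → α ≠ y → β = y := by
      intro y h1 h2 hne
      by_contra hβ
      have := hpair y
      rw [h1, h2, if_neg hne.symm, if_neg (Ne.symm hβ)] at this
      apply hη0
      rw [← hα]
      linear_combination s * this - g (X.dist a α) * hs2
    -- Otherwise both spheres have at least three points; the two values have moduli summing to at
    -- least 1, so the mass is at least 3 · 1/2 > 1.
    have hsmall : X.dist a α = 0 ∨ X.dist a α = X.diam ∨ X.dist b α = 0 ∨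
        X.dist b α = X.diam := by
      by_contra! hno
      obtain ⟨h1, h2, h3, h4⟩ := hno
      have hci : (3 : ℝ) ≤ (sphere X a (X.dist a α)).card := by
        exact_mod_cast hX.three_le_card_sphere hcycle huniq a (Nat.pos_of_ne_zero h1)
          (lt_of_le_of_ne (hle _ _) h2)
      have hcj : (3 : ℝ) ≤ (sphere X a (X.dist b α)).card := by
        exact_mod_cast hX.three_le_card_sphere hcycle huniq a (Nat.pos_of_ne_zero h3)
          (lt_of_le_of_ne (hle _ _) h4)
      have hmass := sum_card_sphere_mul_le (hg a) {X.dist a α, X.dist b α}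
      rw [Finset.sum_pair hij] at hmass
      have hnorm := norm_add_le (g (X.dist a α)) (s * g (X.dist b α))
      rw [hα, hη, norm_mul, hsn, one_mul] at hnorm
      have e1 := mul_le_mul_of_nonneg_right hci (sq_nonneg ‖g (X.dist a α)‖)
      have e2 := mul_le_mul_of_nonneg_right hcj (sq_nonneg ‖g (X.dist b α)‖)
      nlinarith [sq_nonneg (‖g (X.dist a α)‖ - ‖g (X.dist b α)‖)]
    have haddA := hX.dist_add_dist_antipode huniq ha'
    have haddB := hX.dist_add_dist_antipode huniq hb'
    have c1 := X.dist_comm (u := a) (v := b)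
    have hab' := haddB a
    have hba' := haddA b
    have c2 := X.dist_comm (u := b') (v := a)
    have c3 := X.dist_comm (u := a') (v := b)
    rcases hsmall with h | h | h | h
    · obtain rfl := hX.1.dist_eq_zero_iff.mp h
      exact Or.inl ⟨rfl, hswap b (by omega) (by simp) hab⟩
    · obtain rfl := (huniq a).unique h ha'
      exact Or.inr (Or.inr (Or.inl ⟨rfl, hswap b' (by omega) (by omega) ha'b'⟩))
    · obtain rfl := hX.1.dist_eq_zero_iff.mp h
      exact Or.inr (Or.inl ⟨rfl, hswap a (by simp) (by omega) hab.symm⟩)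
    · obtain rfl := (huniq b).unique h hb'
      exact Or.inr (Or.inr (Or.inr (Or.inl ⟨rfl, hswap a' (by omega) (by omega) ha'b'.symm⟩)))

end Combinatorial

/-! ### Antipodal transfer and uniqueness of the target -/

section Main

variable {V : Type*} [Fintype V] [DecidableEq V] {X : SimpleGraph V} [DecidableRel X.Adj]
  {M : Matrix V V ℂ}

lemma IsDistanceRegular.exists_transitionMatrix_eq (hX : IsDistanceRegular X) {p q : ℝ}
    (hM : M = (p : ℂ) • (1 : Matrix V V ℂ) + (q : ℂ) • X.adjMatrix ℂ) (t : ℝ) :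
    ∃ g : ℕ → ℂ, (∀ x y, transitionMatrix M t x y = g (X.dist x y)) ∧
      ∀ a, ∑ x, ‖g (X.dist a x)‖ ^ 2 = 1 := by
  obtain ⟨g, hg⟩ := (hX.transitionMatrix_isDistanceInvariant hM t).exists_eq
  refine ⟨g, hg, fun a => ?_⟩
  rw [← sum_norm_sq_transitionMatrix (isHermitian_of_eq hM) t a]
  exact Finset.sum_congr rfl fun x _ => by rw [hg, X.dist_comm]

/-- Perfect state transfer between vertices forces unique antipodes and transfer between them. -/
lemma IsDistanceRegular.antipodal_of_hasVertexPST (hX : IsDistanceRegular X)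
    (hcycle : ¬ IsCycleGraph X) {p q : ℝ}
    (hM : M = (p : ℂ) • (1 : Matrix V V ℂ) + (q : ℂ) • X.adjMatrix ℂ) (hpst : HasVertexPST M) :
    0 < X.diam ∧ (∀ x, ∃! y, X.dist x y = X.diam) ∧ ∃ τ : ℝ, ∃ γ : ℂ, ‖γ‖ = 1 ∧
      ∀ x y, transitionMatrix M τ x y = if X.dist x y = X.diam then γ else 0 := by
  obtain ⟨v, w, hvw, τ, γ, hγ, h⟩ := hpst
  obtain ⟨g, hg, hsum⟩ := hX.exists_transitionMatrix_eq hM τ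
  -- Every distance up to the diameter occurs from `v`, so the single column at `v` determines `g`.
  have hval : ∀ k ≤ X.diam, g k = if k = X.dist v w then γ else 0 := by
    intro k hk
    obtain ⟨x, hx⟩ := hX.exists_dist_eq v hk
    have hxk := congrFun h x
    rw [mulVec_vertexState, hg, X.dist_comm, hx, Pi.smul_apply, vertexState_apply,
      smul_eq_mul] at hxk
    have hwk := congrFun h w
    rw [mulVec_vertexState, hg, X.dist_comm, Pi.smul_apply, vertexState_apply, if_pos rfl,
      smul_eq_mul, mul_one] at hwk
    by_cases hkw : k = X.dist v w
    · rw [if_pos hkw, hkw, hwk]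
    · rw [if_neg hkw, hxk, if_neg, mul_zero]
      rintro rfl
      exact hkw hx.symm
  have hle := dist_le_diam_of_connected hX.1
  have huniq : ∀ x, ∃! y, X.dist x y = X.dist v w := by
    intro x
    have hx := hsum x
    have hterm : ∀ y, ‖g (X.dist x y)‖ ^ 2 = if X.dist x y = X.dist v w then (1 : ℝ) else 0 := by
      intro y
      rw [hval _ (hle x y)]
      split_ifs <;> simp [hγ]
    rw [Finset.sum_congr rfl fun y _ => hterm y, Finset.sum_boole] at hx
    have hcard : (Finset.univ.filter fun y => X.dist x y = X.dist v w).card = 1 := by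
      exact_mod_cast hx
    obtain ⟨y, hy⟩ := Finset.card_eq_one.mp hcard
    refine ⟨y, ?_, fun z hz => ?_⟩
    · have : y ∈ Finset.univ.filter fun y => X.dist x y = X.dist v w := by simp [hy]
      simpa using this
    · have : z ∈ Finset.univ.filter fun y => X.dist x y = X.dist v w := by simpa using hz
      simpa [hy] using this
  have hpos := hX.1.pos_dist_of_ne hvw
  have hd := hX.eq_diam_of_existsUnique hcycle hpos huniq
  refine ⟨hd ▸ hpos, hd ▸ huniq, τ, γ, hγ, fun x y => ?_⟩
  rw [hg, hval _ (hle x y), hd]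

/-- If some pair state with `s ≠ ±1` is an eigenvector of `U(t)`, then `U(t)` is scalar. -/
lemma IsDistanceRegular.transitionMatrix_eq_smul_one (hX : IsDistanceRegular X) {p q : ℝ}
    (hM : M = (p : ℂ) • (1 : Matrix V V ℂ) + (q : ℂ) • X.adjMatrix ℂ) {t s : ℝ} {c : ℂ}
    (hs : s ^ 2 ≠ 1) {a b : V}
    (h : (transitionMatrix M t).mulVec (pairState s a b) = c • pairState s a b) :
    transitionMatrix M t = c • (1 : Matrix V V ℂ) := by
  have hH := isHermitian_of_eq hM
  obtain ⟨g, hg, -⟩ := hX.exists_transitionMatrix_eq hM t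
  set W := transitionMatrix M t - c • (1 : Matrix V V ℂ) with hW
  -- All columns of `W` have the same norm: each is a unit column whose diagonal entry `g 0` is
  -- shifted by `c`.
  have hN : ∀ y, ∑ x, ‖W x y‖ ^ 2 = 1 - ‖g 0‖ ^ 2 + ‖g 0 - c‖ ^ 2 := by
    intro y
    have h1 := sum_norm_sq_transitionMatrix hH t y
    rw [← Finset.add_sum_erase _ _ (Finset.mem_univ y)] at h1 ⊢
    have h2 : ∀ x ∈ Finset.univ.erase y, ‖W x y‖ ^ 2 = ‖transitionMatrix M t x y‖ ^ 2 := by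
      intro x hx
      rw [hW, Matrix.sub_apply, Matrix.smul_apply, Matrix.one_apply_ne (Finset.ne_of_mem_erase hx),
        smul_zero, sub_zero]
    rw [Finset.sum_congr rfl h2, hW, Matrix.sub_apply, Matrix.smul_apply, Matrix.one_apply_eq,
      smul_eq_mul, mul_one]
    rw [hg y y, X.dist_self] at h1 ⊢
    linarith
  have hWab : ∀ x, ‖W x a‖ ^ 2 = s ^ 2 * ‖W x b‖ ^ 2 := by
    intro x
    have hx : W.mulVec (pairState s a b) x = 0 := by
      rw [hW, Matrix.sub_mulVec, h, Matrix.smul_mulVec, Matrix.one_mulVec, sub_self,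
        Pi.zero_apply]
    rw [mulVec_pairState] at hx
    rw [eq_neg_of_add_eq_zero_left hx, norm_neg, norm_mul, Complex.norm_real, mul_pow,
      Real.norm_eq_abs, sq_abs]
  have hzero : 1 - ‖g 0‖ ^ 2 + ‖g 0 - c‖ ^ 2 = 0 := by
    have h1 := hN a
    rw [Finset.sum_congr rfl fun x _ => hWab x, ← Finset.mul_sum, hN b] at h1
    have h2 : (s ^ 2 - 1) * (1 - ‖g 0‖ ^ 2 + ‖g 0 - c‖ ^ 2) = 0 := by linear_combination h1
    exact (mul_eq_zero.mp h2).resolve_left (sub_ne_zero.mpr hs)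
  rw [← sub_eq_zero, ← hW]
  ext x y
  have h1 := hN y
  rw [hzero, Finset.sum_eq_zero_iff_of_nonneg fun _ _ => by positivity] at h1
  simpa using h1 x (Finset.mem_univ x)

/-- Pair state transfer to a distinct state sends the pair to the pair of antipodes. -/
lemma IsDistanceRegular.sameState_antipodes (hX : IsDistanceRegular X)
    (hcycle : ¬ IsCycleGraph X) {p q : ℝ}
    (hM : M = (p : ℂ) • (1 : Matrix V V ℂ) + (q : ℂ) • X.adjMatrix ℂ)
    (hd : 0 < X.diam) (huniq : ∀ x, ∃! y, X.dist x y = X.diam) {τ : ℝ} {γ : ℂ} (hγ : ‖γ‖ = 1)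
    (hτ : ∀ x y, transitionMatrix M τ x y = if X.dist x y = X.diam then γ else 0)
    {s : ℝ} (hs : s ≠ 0) {a b a' b' α β : V} (hab : a ≠ b) (hαβ : α ≠ β)
    (ha' : X.dist a a' = X.diam) (hb' : X.dist b b' = X.diam)
    (hτab : (transitionMatrix M τ).mulVec (pairState s a b) = γ • pairState s a' b')
    (hdist : ¬ SameState (pairState s a b) (pairState s α β))
    (hpst : PerfectStateTransfer M (pairState s a b) (pairState s α β)) :
    SameState (pairState s a' b') (pairState s α β) := by
  have hne := hX.1.nonempty
  have hH := isHermitian_of_eq hM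
  obtain ⟨t, η, hη, h⟩ := hpst
  have hsymm : ∀ t x y, transitionMatrix M t x y = transitionMatrix M t y x := fun t x y =>
    hX.transitionMatrix_isDistanceInvariant hM t _ _ _ _ X.dist_comm
  have ha'b' : a' ≠ b' := by
    rintro rfl
    exact hab ((huniq a').unique (by rw [X.dist_comm, ha']) (by rw [X.dist_comm, hb']))
  have hγ0 : γ ≠ 0 := by
    rintro rfl
    simp at hγ
  have hτ1 : τ ∉ scalarTimes M hH := by
    rintro ⟨c, hc⟩
    have h1 := hτ a a'
    have hne : a ≠ a' := by
      rintro rfl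
      simp at ha'
      omega
    rw [hc, if_pos ha', Matrix.smul_apply, Matrix.one_apply_ne hne, smul_zero] at h1
    exact hγ0 h1.symm
  have hτ2 : 2 * τ ∈ scalarTimes M hH := by
    refine ⟨γ ^ 2, transitionMatrix_two_mul_of_real hH hγ (hsymm τ) fun x y => ?_⟩
    rw [hτ]
    split_ifs
    · exact ⟨1, by simp⟩
    · exact ⟨0, by simp⟩
  have hnot : t ∉ scalarTimes M hH := by
    rintro ⟨c, hc⟩
    have hcn := norm_eq_one_of_eq_smul_one hH hc
    rw [hc, Matrix.smul_mulVec, Matrix.one_mulVec] at h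
    exact hdist (sameState_of_smul_eq_smul hcn hη h)
  have hperiod : 2 * t ∈ scalarTimes M hH → ∃ c : ℂ, ‖c‖ = 1 ∧
      transitionMatrix M t = c • transitionMatrix M τ := by
    intro ht2
    obtain ⟨c, hc⟩ := (sub_mem_scalarTimes hH hτ1 hτ2 ht2).resolve_left hnot
    refine ⟨c, norm_eq_one_of_eq_smul_one hH hc, ?_⟩
    rw [← sub_add_cancel t τ, transitionMatrix_add, hc, Matrix.smul_mul, one_mul]
  have hscalar : 2 * t ∈ scalarTimes M hH →
      SameState (pairState s a' b') (pairState s α β) := by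
    intro ht2
    obtain ⟨c, hc, hct⟩ := hperiod ht2
    rw [hct, Matrix.smul_mulVec, hτab, smul_smul] at h
    exact sameState_of_smul_eq_smul (by simp [hc, hγ]) hη h
  have h2 := transitionMatrix_two_mul_mulVec hH hη (hsymm t) (star_pairState s a b)
    (star_pairState s α β) h
  by_cases hs1 : s ^ 2 = 1
  · have hs1' : s = 1 ∨ s = -1 := mul_self_eq_one_iff.mp (by rw [← sq, hs1])
    have hsC : (s : ℂ) = 1 ∨ (s : ℂ) = -1 := by
      rcases hs1' with rfl | rfl <;> simp
    obtain ⟨g, hg, hsum⟩ := hX.exists_transitionMatrix_eq hM t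
    have hpair : ∀ x, g (X.dist a x) + s * g (X.dist b x) =
        η * ((if x = α then 1 else 0) + s * (if x = β then 1 else 0)) := by
      intro x
      have := congrFun h x
      rwa [mulVec_pairState, hg, hg, Pi.smul_apply, pairState_apply, smul_eq_mul,
        X.dist_comm, X.dist_comm (u := x) (v := b)] at this
    have hsame : ∀ {a b : V}, a ≠ b → (α = a ∧ β = b) ∨ (α = b ∧ β = a) →
        SameState (pairState s a b) (pairState s α β) := by
      intro a b hab h
      rw [sameState_pairState_iff hs hab hαβ]
      rcases h with ⟨rfl, rfl⟩ | ⟨rfl, rfl⟩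
      · exact Or.inl ⟨rfl, rfl⟩
      · exact Or.inr ⟨hs1', rfl, rfl⟩
    rcases hX.pair_eq_or_real hcycle huniq hsum hsC hη hab hαβ ha' hb' hpair with
      h' | h' | h' | h' | hreal
    · exact absurd (hsame hab (Or.inl h')) hdist
    · exact absurd (hsame hab (Or.inr h')) hdist
    · exact hsame ha'b' (Or.inl h')
    · exact hsame ha'b' (Or.inr h')
    · exact hscalar ⟨η ^ 2, transitionMatrix_two_mul_of_real hH hη (hsymm t) fun x y => by
        rw [hg]
        exact hreal _ (dist_le_diam_of_connected hX.1 x y)⟩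
  · exact hscalar ⟨η ^ 2, hX.transitionMatrix_eq_smul_one hM hs1 h2⟩

end Main

end PairTransfer

theorem mainTheorem2 {V : Type*} [Fintype V] [DecidableEq V] (X : SimpleGraph V)
    [DecidableRel X.Adj] (hX : PairTransfer.IsDistanceRegular X)
    (hcycle : ¬ PairTransfer.IsCycleGraph X)
    (M : Matrix V V ℂ)
    (hM : M = X.adjMatrix ℂ ∨ M = X.lapMatrix ℂ ∨ M = PairTransfer.signlessLapMatrix X)
    (hpst : PairTransfer.HasVertexPST M)
    (s : ℝ) (hs : s ≠ 0) (a b α β : V) (hab : a ≠ b) (hαβ : α ≠ β) :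
    (¬ PairTransfer.SameState (PairTransfer.pairState s a b) (PairTransfer.pairState s α β) ∧
        PairTransfer.PerfectStateTransfer M
          (PairTransfer.pairState s a b) (PairTransfer.pairState s α β)) ↔
      (¬ PairTransfer.IsAntipodalPair X a b ∧
          ((PairTransfer.IsAntipodalPair X a α ∧ PairTransfer.IsAntipodalPair X b β) ∨
            ((s = 1 ∨ s = -1) ∧
              PairTransfer.IsAntipodalPair X a β ∧ PairTransfer.IsAntipodalPair X b α))) ∨
        (PairTransfer.IsAntipodalPair X a b ∧ α = b ∧ β = a ∧ s ≠ 1 ∧ s ≠ -1) := by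
  open PairTransfer in
  obtain ⟨p, q, hM⟩ := hX.exists_eq_smul_one_add hM
  obtain ⟨hd, huniq, τ, γ, hγ, hτ⟩ := hX.antipodal_of_hasVertexPST hcycle hM hpst
  obtain ⟨a', ha', -⟩ := huniq a
  obtain ⟨b', hb', -⟩ := huniq b
  have hanti : ∀ {x x'}, X.dist x x' = X.diam → ∀ y, IsAntipodalPair X x y ↔ y = x' :=
    fun hx y => ⟨fun h => (huniq _).unique h hx, fun h => h ▸ hx⟩
  have ha'b' : a' ≠ b' := by
    rintro rfl
    exact hab ((huniq a').unique (by rw [X.dist_comm, ha']) (by rw [X.dist_comm, hb']))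
  have haa' : a ≠ a' := by
    rintro rfl
    rw [X.dist_self] at ha'
    omega
  -- Antipodality is symmetric, so an antipodal pair is exchanged as a whole.
  have hba : b = a' ↔ a = b' := by
    rw [← hanti ha', ← hanti hb', IsAntipodalPair, IsAntipodalPair, X.dist_comm]
  have hτab : (transitionMatrix M τ).mulVec (pairState s a b) = γ • pairState s a' b' := by
    ext x
    have h1 : X.dist x a = X.diam ↔ x = a' := by rw [X.dist_comm]; exact hanti ha' x
    have h2 : X.dist x b = X.diam ↔ x = b' := by rw [X.dist_comm]; exact hanti hb' x
    rw [mulVec_pairState, hτ, hτ, Pi.smul_apply, pairState_apply, smul_eq_mul]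
    simp only [h1, h2]
    split_ifs <;> ring
  have hiff : PerfectStateTransfer M (pairState s a b) (pairState s α β) ∧
        ¬ SameState (pairState s a b) (pairState s α β) ↔
      SameState (pairState s a' b') (pairState s α β) ∧
        ¬ SameState (pairState s a b) (pairState s α β) := by
    refine and_congr_left fun hdist => ⟨fun h => ?_, ?_⟩
    · exact hX.sameState_antipodes hcycle hM hd huniq hγ hτ hs hab hαβ ha' hb' hτab hdist h
    · rintro ⟨η, hη, h⟩
      exact ⟨τ, γ * η, by simp [hγ, hη], by rw [hτab, h, smul_smul]⟩
  rw [and_comm, hiff, sameState_pairState_iff hs ha'b' hαβ, sameState_pairState_iff hs hab hαβ,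
    hanti ha', hanti ha', hanti ha', hanti hb', hanti hb']
  -- If a, b are not antipodal, a' lies outside {a, b}, so the antipodal state is new. If they are,
  -- the entries are swapped, which gives a new state exactly when s ≠ ±1.
  grind
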